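/- Let $H$ be a compact Hopf $*$-algebra: a complex Hopf algebra, with coproduct $\Delta(h)=h_1\otimes h_2$, counit and antipode $S$, such that every finite-dimensional right $H$-comodule is a direct sum of simple comodules, together with an involutive conjugate-linear anti-homomorphism $*$ such that every simple right comodule $V$, with coaction $v\mapsto v_0\otimes v_1\in V\otimes H$, admits a scalar product (linear in the first variable) satisfying $\langle v_0,w\rangle S(v_1)=\langle v,w_0\rangle w_1^*$ for all $v,w\in V$. Let $\int:H\to\mathbb C$ be the normalized left integral of $H$, i.e. the linear functional with $x_1\int(x_2)=\int(x)\,1$ for all $x\in H$ and $\int(1)=1$. Define the convolution product on $H$ by $f*g:=\int\bigl(g\,S(f_1)\bigr)f_2$. Then $\langle a,b\rangle:=\int(ab^*)$ is a scalar product on $H$ (Hermitian and positive definite), and the associated norm $\|f\|_{L^2}=\langle f,f\rangle^{1/2}$ satisfies $$\|f*g\|_{L^2}\le\|f\|_{L^2}\,\|g\|_{L^2}\qquad\text{for all } f,g\in H.$$ Consequently the convolution product extends uniquely to a continuous map $H_{L^2}\times H_{L^2}\to H_{L^2}$ on the Hilbert space completion $H_{L^2}$ of $H$ with respect to $\|\cdot\|_{L^2}$;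 this extension is bilinear and satisfies the same inequality. -/

import Mathlib

open scoped TensorProduct ComplexConjugate

universe u

noncomputable section

/-! ### Scalar products and the Hilbert space completion -/

/-- A sesquilinear form `s` (linear in the first variable, conjugate-linear in the second one)
on a complex vector space is a scalar product if it is Hermitian and positive definite. -/
structure IsScalarProduct {V : Type u} [AddCommGroup V] [Module ℂ V]
    (s : V →ₗ[ℂ] V →ₗ⋆[ℂ] ℂ) : Prop where
  conj_symm : ∀ v w : V, conj (s w v) = s v w
  pos : ∀ v : V, v ≠ 0 → 0 < (s v v).re

/-- The vector space `V`, to be equipped with the inner product given by the scalar product `s`. -/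
def PreHilbert {V : Type u} [AddCommGroup V] [Module ℂ V]
    {s : V →ₗ[ℂ] V →ₗ⋆[ℂ] ℂ} (_hs : IsScalarProduct s) : Type u := V

namespace PreHilbert

variable {V : Type u} [AddCommGroup V] [Module ℂ V]
  {s : V →ₗ[ℂ] V →ₗ⋆[ℂ] ℂ} (hs : IsScalarProduct s)

instance instAddCommGroup : AddCommGroup (PreHilbert hs) := inferInstanceAs (AddCommGroup V)

instance instModule : Module ℂ (PreHilbert hs) := inferInstanceAs (Module ℂ V)

/-- The identity map from `V` to `V` equipped with its inner product. -/
def of : V ≃ₗ[ℂ] PreHilbert hs := LinearEquiv.refl ℂ V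

/-- Mathlib's inner products are linear in the second variable, whence the swap. -/
@[reducible]
def core : InnerProductSpace.Core ℂ (PreHilbert hs) where
  inner x y := s ((of hs).symm y) ((of hs).symm x)
  conj_inner_symm x y := hs.conj_symm _ _
  re_inner_nonneg x := by
    by_cases hx : (of hs).symm x = 0
    · simp [hx]
    · exact (hs.pos _ hx).le
  add_left x y z := by simp
  smul_left x y r := by simp
  definite x hx := by
    by_contra h
    have h' : (of hs).symm x ≠ 0 := by simpa using h
    have := hs.pos _ h'
    rw [hx] at this
    simp at this

instance instNormedAddCommGroup : NormedAddCommGroup (PreHilbert hs) :=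
  (core hs).toNormedAddCommGroup

instance instInnerProductSpace : InnerProductSpace ℂ (PreHilbert hs) :=
  InnerProductSpace.ofCore (core hs).toCore

theorem inner_of (v w : V) : inner ℂ (of hs v) (of hs w) = s w v := rfl

theorem norm_of (v : V) : ‖of hs v‖ = √(s v v).re := by
  rw [norm_eq_sqrt_re_inner (𝕜 := ℂ), inner_of]
  rfl

end PreHilbert

/-- The Hilbert space completion of `V` for the scalar product `s`. -/
abbrev HilbertCompletion {V : Type u} [AddCommGroup V] [Module ℂ V]
    {s : V →ₗ[ℂ] V →ₗ⋆[ℂ] ℂ} (hs : IsScalarProduct s) : Type u :=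
  UniformSpace.Completion (PreHilbert hs)

/-- The canonical map from `V` to its Hilbert space completion. -/
def toCompletion {V : Type u} [AddCommGroup V] [Module ℂ V]
    {s : V →ₗ[ℂ] V →ₗ⋆[ℂ] ℂ} (hs : IsScalarProduct s) (v : V) : HilbertCompletion hs :=
  ((PreHilbert.of hs v : PreHilbert hs) : UniformSpace.Completion (PreHilbert hs))

theorem norm_toCompletion {V : Type u} [AddCommGroup V] [Module ℂ V]
    {s : V →ₗ[ℂ] V →ₗ⋆[ℂ] ℂ} (hs : IsScalarProduct s) (v : V) :
    ‖toCompletion hs v‖ = √(s v v).re := by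
  rw [toCompletion, UniformSpace.Completion.norm_coe, PreHilbert.norm_of]

/-! ### Comodules -/

/-- A right coaction of the complex coalgebra `H` on the vector space `V`. -/
structure RightCoaction (H V : Type u) [Ring H] [HopfAlgebra ℂ H]
    [AddCommGroup V] [Module ℂ V] where
  coact : V →ₗ[ℂ] V ⊗[ℂ] H
  counit_coact :
    (TensorProduct.rid ℂ V).toLinearMap ∘ₗ
      (Coalgebra.counit (R := ℂ) (A := H)).lTensor V ∘ₗ coact = LinearMap.id
  coassoc_coact :
    (TensorProduct.assoc ℂ V H H).toLinearMap ∘ₗ coact.rTensor H ∘ₗ coact =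
      (Coalgebra.comul (R := ℂ) (A := H)).lTensor V ∘ₗ coact

namespace RightCoaction

variable {H V : Type u} [Ring H] [HopfAlgebra ℂ H] [AddCommGroup V] [Module ℂ V]

/-- `W` is a subcomodule: `δ(W)` is contained in (the image of) `W ⊗ H`. -/
def IsSubcomodule (δ : RightCoaction H V) (W : Submodule ℂ V) : Prop :=
  ∀ w ∈ W, δ.coact w ∈ LinearMap.range (W.subtype.rTensor H)

/-- `W` is a simple subcomodule: a nonzero subcomodule whose only subcomodules are `0` and `W`. -/
def IsSimpleSubcomodule (δ : RightCoaction H V) (W : Submodule ℂ V) : Prop :=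
  δ.IsSubcomodule W ∧ W ≠ ⊥ ∧ ∀ W' ≤ W, δ.IsSubcomodule W' → W' = ⊥ ∨ W' = W

/-- The comodule `V` is simple. -/
def IsSimple (δ : RightCoaction H V) : Prop := δ.IsSimpleSubcomodule ⊤

/-- For a linear form `φ` on `V` and a linear map `T` of `H`, the map
`v ↦ φ(v₀) T(v₁)`, where `δ(v) = v₀ ⊗ v₁`. -/
def contract (δ : RightCoaction H V) (φ : V →ₗ[ℂ] ℂ) (T : H →ₗ[ℂ] H) : V →ₗ[ℂ] H :=
  (TensorProduct.lid ℂ H).toLinearMap ∘ₗ TensorProduct.map φ T ∘ₗ δ.coact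

/-- The comodule `V` is unitarizable: it has a scalar product `⟨ , ⟩` such that
`⟨v₀, w⟩ S(v₁) = ⟨v, w₀⟩ w₁^*` for all `v, w`.
The right-hand side is written as `(⟨w₀, v⟩ w₁)^*`. -/
def IsUnitarizable [StarRing H] (δ : RightCoaction H V) : Prop :=
  ∃ s : V →ₗ[ℂ] V →ₗ⋆[ℂ] ℂ, IsScalarProduct s ∧
    ∀ v w : V, δ.contract (s.flip w) (HopfAlgebra.antipode ℂ) v =
      star (δ.contract (s.flip v) LinearMap.id w)

end RightCoaction

/-! ### Compact Hopf `*`-algebras -/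

/-- A complex Hopf algebra is co-semisimple if every finite-dimensional comodule is a direct sum
of simple comodules. -/
def IsCosemisimple (H : Type u) [Ring H] [HopfAlgebra ℂ H] : Prop :=
  ∀ (V : Type u) [AddCommGroup V] [Module ℂ V] [FiniteDimensional ℂ V] (δ : RightCoaction H V),
    ∃ (n : ℕ) (W : Fin n → Submodule ℂ V),
      (∀ i, δ.IsSimpleSubcomodule (W i)) ∧ DirectSum.IsInternal W

/-- A compact Hopf `*`-algebra: a co-semisimple complex Hopf algebra with an involutive
conjugate-linear anti-homomorphism `*` (`StarRing` and `StarModule`) such that every simple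
comodule is unitarizable. -/
structure IsCompactHopfStarAlgebra (H : Type u) [Ring H] [HopfAlgebra ℂ H] [StarRing H]
    [StarModule ℂ H] : Prop where
  cosemisimple : IsCosemisimple H
  unitarizable : ∀ (V : Type u) [AddCommGroup V] [Module ℂ V] (δ : RightCoaction H V),
    δ.IsSimple → δ.IsUnitarizable

/-! ### Integral, convolution product, `L²`-norm -/

section Integral

variable {H : Type u} [Ring H] [HopfAlgebra ℂ H]

/-- `I` is a normalized left integral: `I(x) 1 = x₁ I(x₂)` for all `x`, and `I(1) = 1`. -/
structure IsNormalizedLeftIntegral (I : H →ₗ[ℂ] ℂ) : Prop where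
  left_invariant : ∀ x : H,
    TensorProduct.rid ℂ H (I.lTensor H (Coalgebra.comul (R := ℂ) x)) = I x • (1 : H)
  map_one : I 1 = 1

/-- The convolution product `g * f = I(f S(g₁)) g₂`. -/
def convolution (I : H →ₗ[ℂ] ℂ) (g f : H) : H :=
  TensorProduct.lid ℂ H
    ((I ∘ₗ LinearMap.mulLeft ℂ f ∘ₗ HopfAlgebra.antipode ℂ).rTensor H
      (Coalgebra.comul (R := ℂ) g))

variable [StarRing H] [StarModule ℂ H]

/-- The form `⟨a, b⟩ = I(a b^*)`. -/
def l2Form (I : H →ₗ[ℂ] ℂ) : H →ₗ[ℂ] H →ₗ⋆[ℂ] ℂ :=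
  LinearMap.mk₂'ₛₗ (RingHom.id ℂ) (starRingEnd ℂ) (fun a b => I (a * star b))
    (fun a a' b => by simp [add_mul])
    (fun c a b => by simp)
    (fun a b b' => by simp [mul_add])
    (fun c a b => by simp)

/-- The `L²`-norm `‖f‖ = ⟨f, f⟩^{1/2}`. -/
def l2Norm (I : H →ₗ[ℂ] ℂ) (f : H) : ℝ := √(I (f * star f)).re

end Integral

end

/-! Everything is reduced to matrices `u` with `Δ(u_ij) = ∑ u_ik ⊗ u_kj` and `S(u_ij) = u_ji^*`.
Local finiteness, cosemisimplicity and unitarizability show that their entries span `H`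
(`span_unitaryCorep`). On such entries the antipode axioms say that `u` is a unitary matrix over
`H`, from which follow the compatibility of `Δ` with `*`, right invariance of the integral and `∫
x^* = conj (∫ x)`.

Positivity: the operators `x ↦ x₁ φ(x₂)` have adjoints of the same kind (`l2Form_act`), so the
orthogonal of a right coideal is a right coideal. On a simple coideal Schur's lemma makes the Gram
matrix of a suitable basis a scalar `c`, and a trace computation gives `c > 0`
(`IsSimpleCoideal.exists_orthogonal_basis`). Induction on dimension, splitting off one simple
coideal at a time, covers every finite-dimensional coideal, hence every element.

Inequality: the adjoint of `g ↦ f * g` is `h ↦ h₁ ∫(h₂ f^*)` (`l2Form_convolution`). Invariance of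
the integral makes `Δ` isometric for the `L²` forms (`sum_l2Form_mul_l2Form`), so Cauchy-Schwarz on
the second leg bounds this adjoint by `‖f‖` (`norm_act_form_le`). Extension to the completion is
then by density. -/

noncomputable section

namespace CompactHopf

open Coalgebra HopfAlgebra

/-! ### Slices and subcomodules -/

section Slice

variable {H M N : Type*} [AddCommGroup H] [Module ℂ H] [AddCommGroup M] [Module ℂ M]
  [AddCommGroup N] [Module ℂ N]

/-- The map `m ⊗ h ↦ φ(h) m`. -/
def slice (M : Type*) [AddCommGroup M] [Module ℂ M] (φ : H →ₗ[ℂ] ℂ) : M ⊗[ℂ] H →ₗ[ℂ] M :=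
  (TensorProduct.rid ℂ M).toLinearMap ∘ₗ φ.lTensor M

@[simp]
theorem slice_tmul (φ : H →ₗ[ℂ] ℂ) (m : M) (h : H) : slice M φ (m ⊗ₜ h) = φ h • m := by
  simp [slice]

theorem slice_rTensor (φ : H →ₗ[ℂ] ℂ) (f : M →ₗ[ℂ] N) (x : M ⊗[ℂ] H) :
    slice N φ (f.rTensor H x) = f (slice M φ x) := by
  induction x with
  | zero => simp
  | tmul m h => simp
  | add x y hx hy => simp [hx, hy]

theorem eq_sum_slice {ι : Type*} (b : Module.Basis ι ℂ H) (x : M ⊗[ℂ] H) :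
    ∃ s : Finset ι, x = ∑ i ∈ s, slice M (b.coord i) x ⊗ₜ b i := by
  classical
  refine ⟨(TensorProduct.equivFinsuppOfBasisRight b x).support, ?_⟩
  have h := (TensorProduct.equivFinsuppOfBasisRight b).symm_apply_apply x
  rw [TensorProduct.equivFinsuppOfBasisRight_symm_apply, Finsupp.sum] at h
  simp only [TensorProduct.equivFinsuppOfBasisRight_apply] at h
  exact h.symm

/-- Expanding along a basis of `H` recovers `x` from its slices. Subcomodules thus become subspaces
stable under a family of operators, which avoids tensor products of submodules. -/
theorem mem_range_rTensor_iff (W : Submodule ℂ M) (x : M ⊗[ℂ] H) :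
    x ∈ LinearMap.range (W.subtype.rTensor H) ↔ ∀ φ : H →ₗ[ℂ] ℂ, slice M φ x ∈ W := by
  constructor
  · rintro ⟨y, rfl⟩ φ
    rw [slice_rTensor]
    exact (slice W φ y).2
  · intro h
    obtain ⟨s, hs⟩ := eq_sum_slice (Module.Basis.ofVectorSpace ℂ H) x
    rw [hs]
    refine Submodule.sum_mem _ fun i _ => ?_
    exact ⟨⟨_, h _⟩ ⊗ₜ _, by rw [LinearMap.rTensor_tmul]; rfl⟩

end Slice

/-! ### Right coideals as comodules, and local finiteness -/

section Coideal

variable {H : Type u} [Ring H] [HopfAlgebra ℂ H]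

/-- The action `x ↦ x₁ φ(x₂)` of a linear form `φ` on `H`. -/
def act (φ : H →ₗ[ℂ] ℂ) : H →ₗ[ℂ] H := slice H φ ∘ₗ comul

/-- `W` is a right coideal: `Δ(W)` is contained in `W ⊗ H`. -/
def IsCoideal (W : Submodule ℂ H) : Prop := ∀ φ : H →ₗ[ℂ] ℂ, ∀ w ∈ W, act φ w ∈ W

/-- `W` is a minimal nonzero right coideal. -/
def IsSimpleCoideal (W : Submodule ℂ H) : Prop :=
  IsCoideal W ∧ W ≠ ⊥ ∧ ∀ W' ≤ W, IsCoideal W' → W' = ⊥ ∨ W' = W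

theorem IsCoideal.mem_range {W : Submodule ℂ H} (hW : IsCoideal W) {w : H} (hw : w ∈ W) :
    comul w ∈ LinearMap.range (W.subtype.rTensor H) :=
  (mem_range_rTensor_iff W _).2 fun φ => hW φ w hw

theorem map_subtype_eq_bot_iff {W : Submodule ℂ H} {U : Submodule ℂ W} :
    U.map W.subtype = ⊥ ↔ U = ⊥ :=
  (Submodule.map_injective_of_injective W.injective_subtype).eq_iff' (Submodule.map_bot _)

theorem exists_retraction (W : Submodule ℂ H) :
    ∃ π : H →ₗ[ℂ] W, π ∘ₗ W.subtype = LinearMap.id :=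
  W.subtype.exists_leftInverse_of_injective (by simp)

/-- A linear projection onto a subspace. -/
def retraction (W : Submodule ℂ H) : H →ₗ[ℂ] W := (exists_retraction W).choose

theorem retraction_comp (W : Submodule ℂ H) : retraction W ∘ₗ W.subtype = LinearMap.id :=
  (exists_retraction W).choose_spec

/-- Since `Δ(w)` already lies in `W ⊗ H`, the arbitrary projection loses nothing; the comodule
axioms for `W` are then inherited from `H`. -/
theorem IsCoideal.subtype_retraction {W : Submodule ℂ H} (hW : IsCoideal W) (w : W) :
    W.subtype.rTensor H ((retraction W).rTensor H (comul (w : H))) = comul (w : H) := by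
  obtain ⟨y, hy⟩ := hW.mem_range w.2
  rw [← hy, ← LinearMap.comp_apply ((retraction W).rTensor H), ← LinearMap.rTensor_comp,
    retraction_comp]
  simp

/-- The comodule structure of a right coideal. -/
def IsCoideal.coaction {W : Submodule ℂ H} (hW : IsCoideal W) : RightCoaction H W where
  coact := (retraction W).rTensor H ∘ₗ comul ∘ₗ W.subtype
  counit_coact := by
    ext w
    have h (x : H ⊗[ℂ] H) : W.subtype (TensorProduct.rid ℂ W
        ((counit (R := ℂ) (A := H)).lTensor W ((retraction W).rTensor H x))) =
        TensorProduct.rid ℂ H ((counit (R := ℂ) (A := H)).lTensor H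
          (W.subtype.rTensor H ((retraction W).rTensor H x))) := by
      induction x with
      | zero => simp
      | tmul m h => simp
      | add x y hx hy => simp only [map_add, hx, hy]
    have := h (comul (w : H))
    rw [hW.subtype_retraction] at this
    simpa using this
  coassoc_coact := by
    ext1 w
    have h1 (x : W ⊗[ℂ] H) : ((retraction W).rTensor H ∘ₗ comul ∘ₗ W.subtype).rTensor H x =
        ((retraction W).rTensor H).rTensor H ((comul (R := ℂ)).rTensor H
          (W.subtype.rTensor H x)) := by
      simp only [LinearMap.rTensor_comp, LinearMap.comp_apply]
    have h2 (x : (H ⊗[ℂ] H) ⊗[ℂ] H) : TensorProduct.assoc ℂ W H H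
        (((retraction W).rTensor H).rTensor H x) =
        (retraction W).rTensor (H ⊗[ℂ] H) (TensorProduct.assoc ℂ H H H x) := by
      rw [LinearMap.rTensor_tensor]
      simp
    simp only [LinearMap.comp_apply, LinearEquiv.coe_coe]
    rw [h1, h2, Submodule.subtype_apply, hW.subtype_retraction, coassoc_apply]
    rw [← LinearMap.comp_apply (LinearMap.rTensor _ _), LinearMap.rTensor_comp_lTensor,
      ← LinearMap.lTensor_comp_rTensor, LinearMap.comp_apply]

theorem IsCoideal.rTensor_coaction {W : Submodule ℂ H} (hW : IsCoideal W) (w : W) :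
    W.subtype.rTensor H (hW.coaction.coact w) = comul (w : H) :=
  hW.subtype_retraction w

theorem IsCoideal.isSubcomodule_iff {W : Submodule ℂ H} (hW : IsCoideal W) (U : Submodule ℂ W) :
    hW.coaction.IsSubcomodule U ↔ IsCoideal (U.map W.subtype) := by
  have key (φ : H →ₗ[ℂ] ℂ) (w : W) :
      act φ (w : H) = (slice W φ (hW.coaction.coact w) : W) := by
    rw [act, LinearMap.comp_apply, ← hW.rTensor_coaction, slice_rTensor]
    rfl
  constructor
  · rintro h φ _ ⟨w, hw, rfl⟩
    exact ⟨_, (mem_range_rTensor_iff U _).1 (h w hw) φ, (key φ w).symm⟩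
  · intro h w hw
    refine (mem_range_rTensor_iff U _).2 fun φ => ?_
    obtain ⟨y, hy, hyw⟩ := h φ w ⟨w, hw, rfl⟩
    rw [Submodule.subtype_apply, key] at hyw
    rwa [← Subtype.ext hyw]

theorem IsCoideal.isSimpleCoideal_map {W : Submodule ℂ H} (hW : IsCoideal W) {U : Submodule ℂ W}
    (hU : hW.coaction.IsSimpleSubcomodule U) : IsSimpleCoideal (U.map W.subtype) := by
  obtain ⟨h1, h2, h3⟩ := hU
  refine ⟨(hW.isSubcomodule_iff U).1 h1, ?_, fun W' hW' hc => ?_⟩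
  · rwa [Ne, map_subtype_eq_bot_iff]
  · have hle : W' ≤ W := hW'.trans (Submodule.map_subtype_le W U)
    have hm : (W'.comap W.subtype).map W.subtype = W' := by
      rw [Submodule.map_comap_subtype, inf_eq_right.2 hle]
    have := h3 (W'.comap W.subtype) ?_ ((hW.isSubcomodule_iff _).2 (by rwa [hm]))
    · rcases this with h | h
      · left; rw [← hm, h, Submodule.map_bot]
      · right; rw [← hm, h]
    · intro x hx
      obtain ⟨y, hy, hyx⟩ := hW' hx
      rwa [← Subtype.ext hyx]

theorem IsSimpleCoideal.isSimple {W : Submodule ℂ H} (hW : IsSimpleCoideal W) :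
    hW.1.coaction.IsSimple := by
  obtain ⟨h1, h2, h3⟩ := hW
  refine ⟨(IsCoideal.isSubcomodule_iff h1 ⊤).2 (by simpa using h1), ?_, fun U _ hc => ?_⟩
  · intro h
    apply h2
    have := congrArg (Submodule.map W.subtype) h
    simpa using this
  · rcases h3 _ (Submodule.map_subtype_le W U) ((IsCoideal.isSubcomodule_iff h1 U).1 hc)
      with h | h
    · left; rwa [map_subtype_eq_bot_iff] at h
    · right
      apply Submodule.map_injective_of_injective W.injective_subtype
      simpa using h

theorem act_counit (x : H) : act (counit (R := ℂ) (A := H)) x = x := by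
  simp [act, slice]

/-- By coassociativity, `act` is an action of the dual algebra of `H`; orbits `{act φ x}` are
therefore coideals. -/
theorem act_act (φ ψ : H →ₗ[ℂ] ℂ) (x : H) :
    act ψ (act φ x) = act (LinearMap.mul' ℂ ℂ ∘ₗ TensorProduct.map ψ φ ∘ₗ comul) x := by
  have h1 (y : H ⊗[ℂ] H) : comul (slice H φ y) =
      slice (H ⊗[ℂ] H) φ ((comul (R := ℂ)).rTensor H y) := (slice_rTensor φ comul y).symm
  have h2 (z : (H ⊗[ℂ] H) ⊗[ℂ] H) : slice H ψ (slice (H ⊗[ℂ] H) φ z) =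
      slice H (LinearMap.mul' ℂ ℂ ∘ₗ TensorProduct.map ψ φ) (TensorProduct.assoc ℂ H H H z) := by
    induction z with
    | zero => simp
    | add x y hx hy => simp only [map_add, hx, hy]
    | tmul z c =>
      induction z with
      | zero => simp
      | add x y hx hy => simp only [TensorProduct.add_tmul, map_add, hx, hy]
      | tmul a b => simp [smul_smul, mul_comm]
  have h3 (χ : H ⊗[ℂ] H →ₗ[ℂ] ℂ) (y : H ⊗[ℂ] H) :
      slice H χ ((comul (R := ℂ)).lTensor H y) = slice H (χ ∘ₗ comul) y := by
    induction y with
    | zero => simp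
    | tmul m h => simp
    | add x y hx hy => simp only [map_add, hx, hy]
  simp only [act, LinearMap.comp_apply]
  rw [h1, h2, coassoc_apply, h3]
  rfl

/-- Every element lies in a finite-dimensional right coideal. -/
theorem exists_finiteDimensional_coideal (x : H) :
    ∃ V : Submodule ℂ H, IsCoideal V ∧ FiniteDimensional ℂ V ∧ x ∈ V := by
  classical
  obtain ⟨s, hs⟩ := TensorProduct.exists_finset (R := ℂ) (comul (R := ℂ) x)
  have hact (φ : H →ₗ[ℂ] ℂ) : act φ x = ∑ i ∈ s, φ i.2 • i.1 := by
    rw [act, LinearMap.comp_apply, hs]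
    simp
  -- The range of `T` is the orbit of `x`; it lies in the span of the finitely many left legs of
  -- `Δ(x)` and contains `x` through the counit.
  let T : (H →ₗ[ℂ] ℂ) →ₗ[ℂ] H := ∑ i ∈ s, (LinearMap.applyₗ i.2).smulRight i.1
  have hT (φ : H →ₗ[ℂ] ℂ) : T φ = act φ x := by
    simp [T, hact]
  refine ⟨LinearMap.range T, ?_, ?_, counit, ?_⟩
  · rintro ψ _ ⟨φ, rfl⟩
    exact ⟨_, (hT _).trans (by rw [hT, act_act])⟩
  · refine Submodule.finiteDimensional_of_le
      (S₂ := Submodule.span ℂ (s.image Prod.fst : Set H)) ?_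
    rintro _ ⟨φ, rfl⟩
    rw [hT, hact]
    exact Submodule.sum_mem _ fun i hi => Submodule.smul_mem _ _
      (Submodule.subset_span (Finset.mem_coe.2 (Finset.mem_image_of_mem _ hi)))
  · rw [hT, act_counit]

/-- Applied to a basis of a coideal, this writes its vectors as combinations of matrix entries of
the coaction. -/
theorem eq_sum_counit_smul {ι : Type*} [Fintype ι] {x : H} {e v : ι → H}
    (h : comul (R := ℂ) x = ∑ i, e i ⊗ₜ[ℂ] v i) : x = ∑ i, counit (R := ℂ) (e i) • v i := by
  have := rTensor_counit_comul (R := ℂ) x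
  rw [h] at this
  simpa using (congrArg (TensorProduct.lid ℂ H) this).symm

end Coideal

/-! ### Unitary matrix corepresentations -/

section UnitaryCorep

variable {H : Type u} [Ring H] [HopfAlgebra ℂ H] [StarRing H]

/-- A unitary matrix corepresentation of `H`. -/
structure IsUnitaryCorep {n : ℕ} (u : Matrix (Fin n) (Fin n) H) : Prop where
  comul_apply : ∀ i j, comul (R := ℂ) (u i j) = ∑ k, u i k ⊗ₜ[ℂ] u k j
  counit_apply : ∀ i j, counit (R := ℂ) (u i j) = if i = j then 1 else 0
  antipode_apply : ∀ i j, antipode ℂ (u i j) = star (u j i)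

/-- A unitarizable comodule has a basis for which the matrix of the coaction is unitary. -/
theorem exists_basis_of_isUnitarizable {V : Type u} [AddCommGroup V] [Module ℂ V]
    [FiniteDimensional ℂ V] (δ : RightCoaction H V) (hδ : δ.IsUnitarizable) :
    ∃ (n : ℕ) (e : Module.Basis (Fin n) ℂ V) (u : Matrix (Fin n) (Fin n) H),
      IsUnitaryCorep u ∧ ∀ j, δ.coact (e j) = ∑ i, e i ⊗ₜ u i j := by
  obtain ⟨s, hs, hsu⟩ := hδ
  have : FiniteDimensional ℂ (PreHilbert hs) := inferInstanceAs (FiniteDimensional ℂ V)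
  let b := stdOrthonormalBasis ℂ (PreHilbert hs)
  let e : Module.Basis _ ℂ V := b.toBasis.map (PreHilbert.of hs).symm
  have he (i j) : s (e i) (e j) = if i = j then 1 else 0 := by
    have := orthonormal_iff_ite.1 b.orthonormal j i
    rw [show b j = PreHilbert.of hs (e j) by simp [e],
      show b i = PreHilbert.of hs (e i) by simp [e], PreHilbert.inner_of] at this
    simp [this, eq_comm]
  -- In an orthonormal basis, pairing with `e i` is the `i`-th coordinate, so the unitarizability
  -- identity reads `S(u_ij) = u_ji^*`.
  have hcoord (i) : s.flip (e i) = e.coord i := by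
    refine e.ext fun j => ?_
    simp [he, Finsupp.single_apply]
  let u : Matrix (Fin (Module.finrank ℂ (PreHilbert hs))) _ H :=
    fun i j => δ.contract (e.coord i) LinearMap.id (e j)
  have hcon (i) (T : H →ₗ[ℂ] H) (x : V ⊗[ℂ] H) :
      TensorProduct.lid ℂ H (TensorProduct.map (e.coord i) T x) =
        T (TensorProduct.equivFinsuppOfBasisLeft e x i) := by
    induction x with
    | zero => simp
    | tmul m h => simp
    | add x y hx hy => simp only [map_add, hx, hy, Finsupp.add_apply]
  have hu (i j) : u i j = TensorProduct.equivFinsuppOfBasisLeft e (δ.coact (e j)) i := hcon _ _ _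
  have hco (j) : δ.coact (e j) = ∑ i, e i ⊗ₜ u i j := by
    apply (TensorProduct.equivFinsuppOfBasisLeft e).injective
    ext i
    rw [← hu, map_sum, Finsupp.finsetSum_apply, Finset.sum_eq_single i]
    · simp
    · intro k _ hk
      simp [hk]
    · simp
  refine ⟨_, e, u, ⟨fun i j => ?_, fun i j => ?_, fun i j => ?_⟩, hco⟩
  · have h := LinearMap.congr_fun δ.coassoc_coact (e j)
    simp only [LinearMap.comp_apply, LinearEquiv.coe_coe, hco, map_sum, LinearMap.rTensor_tmul,
      LinearMap.lTensor_tmul, TensorProduct.sum_tmul, TensorProduct.assoc_tmul] at h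
    have h' := congrArg (fun x => TensorProduct.lid ℂ _ ((e.coord i).rTensor (H ⊗[ℂ] H) x)) h
    simpa [Finsupp.single_apply, ite_smul, Finset.sum_ite_eq] using h'.symm
  · have h := LinearMap.congr_fun δ.counit_coact (e j)
    simp only [LinearMap.comp_apply, LinearEquiv.coe_coe, hco, map_sum,
      LinearMap.lTensor_tmul, TensorProduct.rid_tmul, LinearMap.id_apply] at h
    have h' := congrArg (e.coord i) h
    simpa [Finsupp.single_apply, eq_comm] using h'
  · have h := hsu (e j) (e i)
    rw [hcoord, hcoord] at h
    rw [hu, ← hcon]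
    exact h

/-- A finite-dimensional simple right coideal has a basis on which `H` coacts by a unitary matrix. -/
theorem IsSimpleCoideal.exists_basis {W : Submodule ℂ H} [FiniteDimensional ℂ W]
    [StarModule ℂ H] (hH : IsCompactHopfStarAlgebra H) (hW : IsSimpleCoideal W) :
    ∃ (n : ℕ) (e : Module.Basis (Fin n) ℂ W) (u : Matrix (Fin n) (Fin n) H),
      IsUnitaryCorep u ∧ ∀ j, comul (R := ℂ) (e j : H) = ∑ i, (e i : H) ⊗ₜ[ℂ] u i j := by
  obtain ⟨n, e, u, hu, he⟩ := exists_basis_of_isUnitarizable _ (hH.unitarizable _ _ hW.isSimple)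
  refine ⟨n, e, u, hu, fun j => ?_⟩
  rw [← hW.1.rTensor_coaction, he]
  simp

/-- `H` is spanned by the entries of its unitary matrix corepresentations. -/
theorem span_unitaryCorep [StarModule ℂ H] (hH : IsCompactHopfStarAlgebra H) :
    Submodule.span ℂ {x : H | ∃ (n : ℕ) (u : Matrix (Fin n) (Fin n) H) (i j : Fin n),
      IsUnitaryCorep u ∧ u i j = x} = ⊤ := by
  rw [eq_top_iff]
  rintro x -
  obtain ⟨V, hV, hfin, hx⟩ := exists_finiteDimensional_coideal x
  obtain ⟨m, W, hW, hint⟩ := hH.cosemisimple V hV.coaction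
  have hmem : (⟨x, hx⟩ : V) ∈ ⨆ i, W i := by
    rw [hint.submodule_iSup_eq_top]; trivial
  have hle : (⨆ i, W i).map V.subtype ≤ Submodule.span ℂ {x : H | ∃ (n : ℕ)
      (u : Matrix (Fin n) (Fin n) H) (i j : Fin n), IsUnitaryCorep u ∧ u i j = x} := by
    rw [Submodule.map_iSup]
    refine iSup_le fun i => ?_
    have hsimp := hV.isSimpleCoideal_map (hW i)
    obtain ⟨n, e, u, hu, he⟩ := hsimp.exists_basis hH
    intro y hy
    rw [← show ((⟨y, hy⟩ : Submodule.map V.subtype (W i)) : H) = y from rfl,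
      ← e.sum_repr ⟨y, hy⟩, Submodule.coe_sum]
    refine Submodule.sum_mem _ fun j _ => ?_
    rw [Submodule.coe_smul, eq_sum_counit_smul (he j)]
    exact Submodule.smul_mem _ _ (Submodule.sum_mem _ fun k _ => Submodule.smul_mem _ _
      (Submodule.subset_span ⟨n, u, k, j, hu, rfl⟩))
  exact hle ⟨⟨x, hx⟩, hmem, rfl⟩

end UnitaryCorep

/-! ### The coproduct and the involution -/

section Star

open Matrix

variable {H : Type u} [Ring H] [HopfAlgebra ℂ H] [StarRing H]

namespace IsUnitaryCorep

variable {n : ℕ} {u : Matrix (Fin n) (Fin n) H}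

theorem conjTranspose_mul (hu : IsUnitaryCorep u) : uᴴ * u = 1 := by
  ext i j
  have := mul_antipode_rTensor_comul_apply (R := ℂ) (u i j)
  rw [hu.comul_apply, hu.counit_apply] at this
  simp only [map_sum, LinearMap.rTensor_tmul, LinearMap.mul'_apply, hu.antipode_apply] at this
  rw [Matrix.mul_apply, Matrix.one_apply]
  simp only [Matrix.conjTranspose_apply, this]
  split_ifs <;> simp

theorem mul_conjTranspose (hu : IsUnitaryCorep u) : u * uᴴ = 1 := by
  ext i j
  have := mul_antipode_lTensor_comul_apply (R := ℂ) (u i j)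
  rw [hu.comul_apply, hu.counit_apply] at this
  simp only [map_sum, LinearMap.lTensor_tmul, LinearMap.mul'_apply, hu.antipode_apply] at this
  rw [Matrix.mul_apply, Matrix.one_apply]
  simp only [Matrix.conjTranspose_apply, this]
  split_ifs <;> simp

/-- Uniqueness of inverses in matrices over `H ⊗ H`: with `l`, `r` the two embeddings, `Δ(u) = l(u)
r(u)`, so both `Δ(uᴴ)` and `r(uᴴ) l(uᴴ)` invert `Δ(u)`. -/
theorem comul_star_apply (hu : IsUnitaryCorep u) (i j : Fin n) :
    comul (R := ℂ) (star (u i j)) = ∑ k, star (u i k) ⊗ₜ[ℂ] star (u k j) := by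
  let D : H →+* H ⊗[ℂ] H := (Bialgebra.comulAlgHom ℂ H : H →+* H ⊗[ℂ] H)
  let l : H →+* H ⊗[ℂ] H := (Algebra.TensorProduct.includeLeft : H →ₐ[ℂ] H ⊗[ℂ] H)
  let r : H →+* H ⊗[ℂ] H := (Algebra.TensorProduct.includeRight : H →ₐ[ℂ] H ⊗[ℂ] H)
  have hD : D.mapMatrix u = l.mapMatrix u * r.mapMatrix u := by
    ext i j
    simp [D, l, r, hu.comul_apply, Matrix.mul_apply]
  have h1 : D.mapMatrix uᴴ * D.mapMatrix u = 1 := by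
    rw [← map_mul, hu.conjTranspose_mul, map_one]
  have h2 : D.mapMatrix u * (r.mapMatrix uᴴ * l.mapMatrix uᴴ) = 1 := by
    rw [hD, mul_assoc, ← mul_assoc (r.mapMatrix u), ← map_mul, hu.mul_conjTranspose, map_one,
      one_mul, ← map_mul, hu.mul_conjTranspose, map_one]
  have h3 := congrArg (fun M : Matrix (Fin n) (Fin n) (H ⊗[ℂ] H) => M j i)
    (left_inv_eq_right_inv h1 h2)
  simpa [D, l, r, Matrix.mul_apply] using h3

end IsUnitaryCorep

variable [StarModule ℂ H]

/-- To prove a linear property of the elements of `H`, it suffices to prove it for the entries of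
unitary matrix corepresentations. -/
theorem corep_induction (hH : IsCompactHopfStarAlgebra H) {p : H → Prop}
    (corep : ∀ (n : ℕ) (u : Matrix (Fin n) (Fin n) H), IsUnitaryCorep u → ∀ i j, p (u i j))
    (add : ∀ x y, p x → p y → p (x + y)) (smul : ∀ (c : ℂ) x, p x → p (c • x)) (x : H) : p x := by
  have hx : x ∈ Submodule.span ℂ {x : H | ∃ (n : ℕ) (u : Matrix (Fin n) (Fin n) H) (i j : Fin n),
      IsUnitaryCorep u ∧ u i j = x} := by
    rw [span_unitaryCorep hH]; trivial
  -- The trivial corepresentation serves only to reach `0`, as `0 • 1`.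
  have one : IsUnitaryCorep (fun _ _ => 1 : Matrix (Fin 1) (Fin 1) H) :=
    ⟨by simp [Algebra.TensorProduct.one_def], by simp [Subsingleton.elim _ (0 : Fin 1)], by simp⟩
  induction hx using Submodule.span_induction with
  | mem x hx =>
    obtain ⟨n, u, i, j, hu, rfl⟩ := hx
    exact corep n u hu i j
  | zero => simpa using smul 0 1 (corep 1 _ one 0 0)
  | add x y _ _ hx hy => exact add x y hx hy
  | smul c x _ hx => exact smul c x hx

/-- This compatibility is not part of the definition of a compact Hopf `*`-algebra; it follows from
unitarity of the corepresentations. -/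
theorem comul_star (hH : IsCompactHopfStarAlgebra H) (x : H) :
    comul (R := ℂ) (star x) = star (comul (R := ℂ) x) := by
  induction x using corep_induction hH with
  | corep n u hu i j =>
    rw [hu.comul_star_apply, hu.comul_apply, star_sum]
    rfl
  | add x y hx hy =>
    simp [hx, hy]
  | smul c x hx =>
    rw [star_smul, map_smul, map_smul, star_smul, hx]

theorem comul_star_of_eq_sum (hH : IsCompactHopfStarAlgebra H) {ι : Type*} {s : Finset ι}
    {a b : ι → H} {x : H} (h : comul (R := ℂ) x = ∑ i ∈ s, a i ⊗ₜ[ℂ] b i) :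
    comul (R := ℂ) (star x) = ∑ i ∈ s, star (a i) ⊗ₜ[ℂ] star (b i) := by
  rw [comul_star hH, h, star_sum]
  rfl

theorem act_star (hH : IsCompactHopfStarAlgebra H) {φ ψ : H →ₗ[ℂ] ℂ}
    (h : ∀ y, ψ (star y) = conj (φ y)) (x : H) : act ψ (star x) = star (act φ x) := by
  obtain ⟨s, hs⟩ := TensorProduct.exists_finset (R := ℂ) (comul (R := ℂ) x)
  simp only [act, LinearMap.comp_apply, comul_star_of_eq_sum hH hs, hs, map_sum, slice_tmul, h,
    star_sum, star_smul, starRingEnd_apply]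

end Star

/-! ### Two-sided invariance and reality of the integral -/

section Integral

open Matrix

variable {H : Type u} [Ring H] [HopfAlgebra ℂ H] {I : H →ₗ[ℂ] ℂ}

theorem act_integral (hI : IsNormalizedLeftIntegral I) (x : H) : act I x = I x • (1 : H) :=
  hI.left_invariant x

theorem sum_integral {ι : Type*} {s : Finset ι} {a b : ι → H} {x : H}
    (hI : IsNormalizedLeftIntegral I) (h : comul (R := ℂ) x = ∑ i ∈ s, a i ⊗ₜ[ℂ] b i) :
    ∑ i ∈ s, I (b i) • a i = I x • 1 := by
  rw [← act_integral hI, act, LinearMap.comp_apply, h]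
  simp

variable [StarRing H] [StarModule ℂ H]

/-- Left invariance is `u P = P` for `P = I(u)`. Unitarity turns it into `P = uᴴ P`, that is `Pᴴ u =
Pᴴ`; applying `I` gives `Pᴴ P = Pᴴ`, so `P` is self-adjoint and idempotent, and `P u = P`. -/
theorem IsUnitaryCorep.map_integral {n : ℕ} {u : Matrix (Fin n) (Fin n) H} (hu : IsUnitaryCorep u)
    (hI : IsNormalizedLeftIntegral I) :
    (u.map I)ᴴ = u.map I ∧ u.map I * u.map I = u.map I ∧
      (u.map I).map (algebraMap ℂ H) * u = (u.map I).map (algebraMap ℂ H) := by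
  set P := u.map I with hP
  have hmap (A B : Matrix (Fin n) (Fin n) ℂ) : (A * B).map (algebraMap ℂ H) =
      A.map (algebraMap ℂ H) * B.map (algebraMap ℂ H) := Matrix.map_mul
  have hstar (A : Matrix (Fin n) (Fin n) ℂ) :
      (A.map (algebraMap ℂ H))ᴴ = Aᴴ.map (algebraMap ℂ H) := by
    ext i j; simp [Algebra.algebraMap_eq_smul_one]
  have h1 : u * P.map (algebraMap ℂ H) = P.map (algebraMap ℂ H) := by
    ext i j
    have := sum_integral hI (hu.comul_apply i j)
    simpa [Matrix.mul_apply, hP, Algebra.algebraMap_eq_smul_one] using this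
  have h2 : P.map (algebraMap ℂ H) = uᴴ * P.map (algebraMap ℂ H) := by
    conv_rhs => rw [← h1, ← mul_assoc, hu.conjTranspose_mul, one_mul]
  have h3 : Pᴴ.map (algebraMap ℂ H) * u = Pᴴ.map (algebraMap ℂ H) := by
    have := congrArg Matrix.conjTranspose h2
    rw [Matrix.conjTranspose_mul, Matrix.conjTranspose_conjTranspose, hstar] at this
    exact this.symm
  have h4 : Pᴴ * P = Pᴴ := by
    ext i j
    have := congrArg I (congrFun (congrFun h3 i) j)
    simpa [Matrix.mul_apply, hP, Algebra.algebraMap_eq_smul_one, hI.map_one] using this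
  have h5 : Pᴴ = P := by
    have := congrArg Matrix.conjTranspose h4
    rw [Matrix.conjTranspose_mul, Matrix.conjTranspose_conjTranspose, h4] at this
    exact this
  rw [h5] at h3 h4
  exact ⟨h5, h4, h3⟩

theorem right_invariant (hH : IsCompactHopfStarAlgebra H) (hI : IsNormalizedLeftIntegral I)
    (x : H) : TensorProduct.lid ℂ H (I.rTensor H (comul (R := ℂ) x)) = I x • (1 : H) := by
  induction x using corep_induction hH with
  | corep n u hu i j =>
    have := congrFun (congrFun (hu.map_integral hI).2.2 i) j
    simpa [Matrix.mul_apply, hu.comul_apply, Algebra.algebraMap_eq_smul_one] using this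
  | add x y hx hy =>
    simp [hx, hy, add_smul]
  | smul c x hx =>
    simp [hx, mul_smul]

theorem sum_integral_left {ι : Type*} {s : Finset ι} {a b : ι → H} {x : H}
    (hH : IsCompactHopfStarAlgebra H)
    (hI : IsNormalizedLeftIntegral I) (h : comul (R := ℂ) x = ∑ i ∈ s, a i ⊗ₜ[ℂ] b i) :
    ∑ i ∈ s, I (a i) • b i = I x • 1 := by
  rw [← right_invariant hH hI, h]
  simp

/-- Let `P = I(u)` and `Q = conj I(u^*)`, entrywise. Left invariance on the `u_ij^*` gives `P Q =
Q`, right invariance on the `u_ij` gives `P Q = P`. -/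
theorem integral_star (hH : IsCompactHopfStarAlgebra H) (hI : IsNormalizedLeftIntegral I)
    (x : H) : I (star x) = conj (I x) := by
  induction x using corep_induction hH with
  | corep n u hu i j =>
    let P := u.map I
    let Q : Matrix (Fin n) (Fin n) ℂ := fun i j => conj (I (star (u i j)))
    have hPQ : P * Q = Q := by
      ext i j
      have := congrArg (fun x => I (star x)) (sum_integral hI (hu.comul_star_apply i j))
      rw [Matrix.mul_apply]
      simpa [P, Q, hI.map_one, mul_comm] using this
    have hPQ' : P * Q = P := by
      ext i j
      have := congrArg (fun x => conj (I (star x)))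
        (sum_integral_left hH hI (hu.comul_apply i j))
      rw [Matrix.mul_apply]
      simpa [P, Q, hI.map_one, mul_comm] using this
    have := congrFun (congrFun (hPQ.symm.trans hPQ') i) j
    rw [← Complex.conj_conj (I (star (u i j)))]
    exact congrArg conj this
  | add x y hx hy =>
    simp [hx, hy]
  | smul c x hx =>
    simp [hx]

end Integral

/-! ### Bilinearity of the convolution product -/

section Convolution

variable {H : Type u} [Ring H] [HopfAlgebra ℂ H]

theorem act_eq_sum {ι : Type*} {s : Finset ι} {a b : ι → H} {x : H}
    (h : comul (R := ℂ) x = ∑ i ∈ s, a i ⊗ₜ[ℂ] b i) (φ : H →ₗ[ℂ] ℂ) :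
    act φ x = ∑ i ∈ s, φ (b i) • a i := by
  rw [act, LinearMap.comp_apply, h]
  simp

theorem convolution_eq_sum {ι : Type*} {s : Finset ι} {a b : ι → H} {f : H}
    (h : comul (R := ℂ) f = ∑ i ∈ s, a i ⊗ₜ[ℂ] b i) (I : H →ₗ[ℂ] ℂ) (g : H) :
    convolution I f g = ∑ i ∈ s, I (g * antipode ℂ (a i)) • b i := by
  rw [convolution, h]
  simp

theorem convolution_add_left (I : H →ₗ[ℂ] ℂ) (f f' g : H) :
    convolution I (f + f') g = convolution I f g + convolution I f' g := by
  simp [convolution]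

theorem convolution_smul_left (I : H →ₗ[ℂ] ℂ) (c : ℂ) (f g : H) :
    convolution I (c • f) g = c • convolution I f g := by
  simp [convolution]

theorem convolution_add_right (I : H →ₗ[ℂ] ℂ) (f g g' : H) :
    convolution I f (g + g') = convolution I f g + convolution I f g' := by
  obtain ⟨s, hs⟩ := TensorProduct.exists_finset (R := ℂ) (comul (R := ℂ) f)
  simp [convolution_eq_sum hs, add_mul, add_smul, Finset.sum_add_distrib]

theorem convolution_smul_right (I : H →ₗ[ℂ] ℂ) (c : ℂ) (f g : H) :
    convolution I f (c • g) = c • convolution I f g := by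
  obtain ⟨s, hs⟩ := TensorProduct.exists_finset (R := ℂ) (comul (R := ℂ) f)
  simp [convolution_eq_sum hs, mul_smul, Finset.smul_sum]

end Convolution

/-! ### Adjoints for the `L²` form -/

section Form

variable {H : Type u} [Ring H] [HopfAlgebra ℂ H] [StarRing H] [StarModule ℂ H] {I : H →ₗ[ℂ] ℂ}

@[simp]
theorem l2Form_apply (I : H →ₗ[ℂ] ℂ) (a b : H) : l2Form I a b = I (a * star b) := rfl

theorem l2Form_conj_symm (hH : IsCompactHopfStarAlgebra H) (hI : IsNormalizedLeftIntegral I)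
    (a b : H) : conj (l2Form I b a) = l2Form I a b := by
  simp [← integral_star hH hI]

theorem comul_mul_star (hH : IsCompactHopfStarAlgebra H) {ι κ : Type*} {s : Finset ι}
    {t : Finset κ} {a b : ι → H} {c d : κ → H} {x y : H}
    (hx : comul (R := ℂ) x = ∑ i ∈ s, a i ⊗ₜ[ℂ] b i)
    (hy : comul (R := ℂ) y = ∑ j ∈ t, c j ⊗ₜ[ℂ] d j) :
    comul (R := ℂ) (x * star y) =
      ∑ p ∈ s ×ˢ t, (a p.1 * star (c p.2)) ⊗ₜ[ℂ] (b p.1 * star (d p.2)) := by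
  rw [Bialgebra.comul_mul, hx, comul_star_of_eq_sum hH hy, Finset.sum_mul_sum,
    Finset.sum_product]
  simp

/-- The linear form `x ↦ conj φ(S(x^*))`. -/
def adjointForm (φ : H →ₗ[ℂ] ℂ) : H →ₗ[ℂ] ℂ where
  toFun x := conj (φ (antipode ℂ (star x)))
  map_add' x y := by simp
  map_smul' c x := by simp

/-- In Sweedler notation, `I(v₁ w^*) v₂ = I(v₁ w₁^*) v₂ w₂^* S(w₃^*) = I(v w₁^*) S(w₂^*)`, the last
step by right invariance; then apply `φ`. -/
theorem l2Form_act (hH : IsCompactHopfStarAlgebra H) (hI : IsNormalizedLeftIntegral I)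
    (φ : H →ₗ[ℂ] ℂ) (v w : H) :
    l2Form I (act φ v) w = l2Form I v (act (adjointForm φ) w) := by
  induction w using corep_induction hH with
  | corep n z hz l k =>
    obtain ⟨s, hs⟩ := TensorProduct.exists_finset (R := ℂ) (comul (R := ℂ) v)
    have h1 (m : Fin n) : I (v * star (z l m)) • (1 : H) = ∑ i ∈ s, ∑ p,
        I (i.1 * star (z l p)) • (i.2 * star (z p m)) := by
      rw [← sum_integral_left hH hI (comul_mul_star hH hs (hz.comul_apply l m)),
        Finset.sum_product]
    have h2 (p : Fin n) : ∑ m, star (z p m) * antipode ℂ (star (z m k)) = if p = k then 1 else 0 := by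
      have := mul_antipode_lTensor_comul_apply (R := ℂ) (star (z p k))
      rw [hz.comul_star_apply] at this
      simp only [map_sum, LinearMap.lTensor_tmul, LinearMap.mul'_apply] at this
      -- The counit of `z_pk^*` is found by writing it as `S(z_kp)` and using `ε ∘ S = ε`.
      rw [this, ← hz.antipode_apply k p, counit_antipode, hz.counit_apply]
      simp only [eq_comm (a := k)]
      split_ifs <;> simp
    have key : ∑ i ∈ s, I (i.1 * star (z l k)) • i.2 =
        ∑ m, I (v * star (z l m)) • antipode ℂ (star (z m k)) := by
      calc ∑ i ∈ s, I (i.1 * star (z l k)) • i.2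
          = ∑ i ∈ s, ∑ p, I (i.1 * star (z l p)) • (i.2 * if p = k then 1 else 0) := by
            simp
        _ = ∑ i ∈ s, ∑ p, ∑ m, I (i.1 * star (z l p)) •
              (i.2 * star (z p m) * antipode ℂ (star (z m k))) := by
            simp only [← h2, Finset.mul_sum, Finset.smul_sum, mul_assoc]
        _ = ∑ m, (I (v * star (z l m)) • (1 : H)) * antipode ℂ (star (z m k)) := by
            simp only [h1, Finset.sum_mul, smul_mul_assoc]
            rw [Finset.sum_comm (s := Finset.univ) (t := s)]
            exact Finset.sum_congr rfl fun i _ => Finset.sum_comm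
        _ = _ := by simp
    rw [act_eq_sum hs, act_eq_sum (hz.comul_apply l k)]
    have := congrArg φ key
    simpa [Finset.sum_mul, Finset.mul_sum, adjointForm, mul_comm] using this
  | add x y hx hy => simp only [map_add, hx, hy]
  | smul c x hx => simp only [map_smul, map_smulₛₗ, hx]

/-- The linear form `x ↦ I(x f^*)`. -/
def form (I : H →ₗ[ℂ] ℂ) (f : H) : H →ₗ[ℂ] ℂ := (l2Form I).flip f

@[simp]
theorem form_apply (I : H →ₗ[ℂ] ℂ) (f x : H) : form I f x = I (x * star f) := rfl

/-- By left invariance, `S(f₁) I(f₂ h^*) = S(f₁) f₂ h₁^* I(f₃ h₂^*) = h₁^* I(f h₂^*)`; multiply by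
`g` on the left and integrate. -/
theorem l2Form_convolution_eq_sum (hH : IsCompactHopfStarAlgebra H)
    (hI : IsNormalizedLeftIntegral I) {ι : Type*} {s : Finset ι} {a b : ι → H} {h : H}
    (hs : comul (R := ℂ) h = ∑ i ∈ s, a i ⊗ₜ[ℂ] b i) (f g : H) :
    l2Form I (convolution I f g) h = ∑ q ∈ s, I (f * star (b q)) * I (g * star (a q)) := by
  induction f using corep_induction hH with
  | corep n u hu i j =>
    have h1 (k : Fin n) : I (u k j * star h) • (1 : H) = ∑ m, ∑ q ∈ s,
        I (u m j * star (b q)) • (u k m * star (a q)) := by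
      rw [← sum_integral hI (comul_mul_star hH (hu.comul_apply k j) hs),
        Finset.sum_product]
    have h2 (m : Fin n) : ∑ k, antipode ℂ (u i k) * u k m = if i = m then 1 else 0 := by
      have := mul_antipode_rTensor_comul_apply (R := ℂ) (u i m)
      rw [hu.comul_apply] at this
      simp only [map_sum, LinearMap.rTensor_tmul, LinearMap.mul'_apply] at this
      rw [this, hu.counit_apply]
      split_ifs <;> simp
    have key : ∑ k, I (u k j * star h) • antipode ℂ (u i k) =
        ∑ q ∈ s, I (u i j * star (b q)) • star (a q) := by
      calc ∑ k, I (u k j * star h) • antipode ℂ (u i k)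
          = ∑ k, antipode ℂ (u i k) * (I (u k j * star h) • (1 : H)) := by simp
        _ = ∑ k, ∑ m, ∑ q ∈ s,
              I (u m j * star (b q)) • (antipode ℂ (u i k) * u k m * star (a q)) := by
            simp only [h1, Finset.mul_sum, mul_smul_comm, mul_assoc]
        _ = ∑ m, ∑ q ∈ s, I (u m j * star (b q)) • ((if i = m then 1 else 0) * star (a q)) := by
            rw [Finset.sum_comm]
            refine Finset.sum_congr rfl fun m _ => ?_
            rw [Finset.sum_comm]
            simp only [← h2, Finset.sum_mul, Finset.smul_sum]
        _ = _ := by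
            rw [Finset.sum_comm]
            simp
    have := congrArg (fun x => I (g * x)) key
    rw [convolution_eq_sum (hu.comul_apply i j)]
    simpa [Finset.sum_mul, Finset.mul_sum, mul_comm] using this
  | add x y hx hy =>
    rw [convolution_add_left, map_add, LinearMap.add_apply, hx, hy, ← Finset.sum_add_distrib]
    simp [add_mul]
  | smul c x hx =>
    rw [convolution_smul_left, map_smul, LinearMap.smul_apply, hx, smul_eq_mul, Finset.mul_sum]
    simp [mul_assoc]

theorem l2Form_convolution (hH : IsCompactHopfStarAlgebra H) (hI : IsNormalizedLeftIntegral I)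
    (f g h : H) : l2Form I (convolution I f g) h = l2Form I g (act (form I f) h) := by
  obtain ⟨s, hs⟩ := TensorProduct.exists_finset (R := ℂ) (comul (R := ℂ) h)
  rw [l2Form_convolution_eq_sum hH hI hs, act_eq_sum hs]
  simp [← integral_star hH hI]

/-- The coproduct is isometric from `H` to `H ⊗ H`: integrate both legs of `Δ(h h^*)` and use
invariance. -/
theorem sum_l2Form_mul_l2Form (hH : IsCompactHopfStarAlgebra H)
    (hI : IsNormalizedLeftIntegral I) {ι : Type*} {s : Finset ι} {a b : ι → H} {h : H}
    (hs : comul (R := ℂ) h = ∑ i ∈ s, a i ⊗ₜ[ℂ] b i) :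
    ∑ i ∈ s, ∑ j ∈ s, l2Form I (a i) (a j) * l2Form I (b i) (b j) = l2Form I h h := by
  have := congrArg I (sum_integral hI (comul_mul_star hH hs hs))
  rw [Finset.sum_product] at this
  simpa [hI.map_one, mul_comm] using this

end Form

/-! ### Schur's lemma -/

section Schur

variable {H : Type u} [Ring H] [HopfAlgebra ℂ H]

open Matrix

/-- Schur's lemma for a coideal. -/
theorem IsSimpleCoideal.eq_scalar {W : Submodule ℂ H} (hW : IsSimpleCoideal W) {n : ℕ}
    {F : Fin n → H} (hF : LinearIndependent ℂ F) (hspan : Submodule.span ℂ (Set.range F) = W)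
    {ρ : Matrix (Fin n) (Fin n) H} (hρ : ∀ j, comul (R := ℂ) (F j) = ∑ i, F i ⊗ₜ[ℂ] ρ i j)
    (N : Matrix (Fin n) (Fin n) ℂ) (hN : ∀ φ : H →ₗ[ℂ] ℂ, N * ρ.map φ = ρ.map φ * N) :
    ∃ c : ℂ, N = c • (1 : Matrix (Fin n) (Fin n) ℂ) := by
  have hn : Nonempty (Fin n) := by
    by_contra h
    rw [not_nonempty_iff] at h
    apply hW.2.1
    rw [← hspan, Set.range_eq_empty, Submodule.span_empty]
  let T : (Fin n → ℂ) →ₗ[ℂ] H := Fintype.linearCombination ℂ F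
  have hT : Function.Injective T := hF.fintypeLinearCombination_injective
  obtain ⟨c, hc⟩ := Module.End.exists_eigenvalue (Matrix.toLin' N)
  -- An eigenspace of `N` is stable under all `ρ.map φ`, so its image under `T` is a nonzero coideal
  -- inside `W`, hence all of `W`.
  let K : Submodule ℂ (Fin n → ℂ) := Module.End.eigenspace (Matrix.toLin' N) c
  have hact (φ : H →ₗ[ℂ] ℂ) (x : Fin n → ℂ) : act φ (T x) = T (ρ.map φ *ᵥ x) := by
    simp only [T, Fintype.linearCombination_apply, map_sum, map_smul, act_eq_sum (hρ _),
      Matrix.mulVec, dotProduct, Finset.smul_sum, Finset.sum_smul, smul_smul, Matrix.map_apply]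
    rw [Finset.sum_comm]
    simp only [mul_comm]
  have hKW : K.map T = W := by
    refine (hW.2.2 (K.map T) ?_ ?_).resolve_left ?_
    · rintro _ ⟨x, -, rfl⟩
      rw [← hspan, ← Fintype.range_linearCombination ℂ F]
      exact ⟨x, rfl⟩
    · rintro φ _ ⟨x, hx, rfl⟩
      rw [hact]
      refine ⟨_, ?_, rfl⟩
      have hx' : N *ᵥ x = c • x := by simpa [K] using hx
      have : N *ᵥ (ρ.map φ *ᵥ x) = c • (ρ.map φ *ᵥ x) := by
        rw [Matrix.mulVec_mulVec, hN, ← Matrix.mulVec_mulVec, hx', Matrix.mulVec_smul]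
      simpa [K] using this
    · rw [(Submodule.map_injective_of_injective hT).eq_iff' (Submodule.map_bot _)]
      exact hc
  refine ⟨c, ?_⟩
  ext i j
  have hj : F j ∈ K.map T := by
    rw [hKW, ← hspan]
    exact Submodule.subset_span ⟨j, rfl⟩
  obtain ⟨x, hx, hxj⟩ := hj
  have hx1 : x = Pi.single j 1 := hT (by simp [hxj, T])
  have hx' : N *ᵥ x = c • x := by simpa [K] using hx
  have := congrFun hx' i
  rw [hx1] at this
  simpa [Matrix.one_apply, Pi.single_apply] using this

end Schur

/-! ### Positive definiteness of the `L²` form -/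

section Positivity

open Matrix

variable {H : Type u} [Ring H] [HopfAlgebra ℂ H] [StarRing H] [StarModule ℂ H] {I : H →ₗ[ℂ] ℂ}

/-- The subspace `W^* = {w^* | w ∈ W}`. -/
def starSubmodule (W : Submodule ℂ H) : Submodule ℂ H :=
  W.comap (starLinearEquiv ℂ : H ≃ₗ⋆[ℂ] H).toLinearMap

theorem mem_starSubmodule {W : Submodule ℂ H} {x : H} : x ∈ starSubmodule W ↔ star x ∈ W := Iff.rfl

theorem starSubmodule_starSubmodule (W : Submodule ℂ H) : starSubmodule (starSubmodule W) = W := by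
  ext x; simp [mem_starSubmodule]

theorem starSubmodule_mono {W W' : Submodule ℂ H} (h : W ≤ W') :
    starSubmodule W ≤ starSubmodule W' := fun _ hx => h hx

theorem starSubmodule_bot : starSubmodule (⊥ : Submodule ℂ H) = ⊥ := by
  ext x; simp [mem_starSubmodule]

theorem finiteDimensional_starSubmodule (W : Submodule ℂ H) [FiniteDimensional ℂ W] :
    FiniteDimensional ℂ (starSubmodule W) := by
  refine Module.Finite.iff_fg.2 ?_
  have h : W.map (starLinearEquiv ℂ : H ≃ₗ⋆[ℂ] H).toLinearMap = starSubmodule W := by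
    ext x
    simp only [Submodule.mem_map, mem_starSubmodule]
    exact ⟨by rintro ⟨y, hy, rfl⟩; simpa using hy, fun hx => ⟨star x, hx, by simp⟩⟩
  rw [← h]
  exact (Module.Finite.iff_fg.1 ‹_›).map _

theorem IsCoideal.starSubmodule (hH : IsCompactHopfStarAlgebra H) {W : Submodule ℂ H}
    (hW : IsCoideal W) : IsCoideal (starSubmodule W) := by
  intro φ w hw
  let ψ : H →ₗ[ℂ] ℂ :=
    { toFun := fun y => conj (φ (star y))
      map_add' := by simp
      map_smul' := by simp }
  rw [mem_starSubmodule] at hw ⊢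
  rw [← act_star hH (φ := φ) (ψ := ψ) (by simp [ψ])]
  exact hW ψ _ hw

theorem IsSimpleCoideal.starSubmodule (hH : IsCompactHopfStarAlgebra H) {W : Submodule ℂ H}
    (hW : IsSimpleCoideal W) : IsSimpleCoideal (starSubmodule W) := by
  refine ⟨hW.1.starSubmodule hH, fun h => hW.2.1 ?_, fun W' hW' hc => ?_⟩
  · rw [← starSubmodule_starSubmodule W, h, starSubmodule_bot]
  · have hle := starSubmodule_mono hW'
    rw [starSubmodule_starSubmodule] at hle
    refine (hW.2.2 _ hle (hc.starSubmodule hH)).imp (fun h => ?_) (fun h => ?_)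
    · rw [← starSubmodule_starSubmodule W', h, starSubmodule_bot]
    · rw [← starSubmodule_starSubmodule W', h]

/-- Two bases are needed. The stars `F` of a unitary basis of `W^*` have a Gram matrix commuting
with the coaction, hence scalar by Schur. A unitary basis `e` of `W` itself then fixes the sign of
the scalar, because `∑ e_b e_b^*` is a positive multiple of `1`. -/
theorem IsSimpleCoideal.exists_orthogonal_basis (hH : IsCompactHopfStarAlgebra H)
    (hI : IsNormalizedLeftIntegral I) {W : Submodule ℂ H} [FiniteDimensional ℂ W]
    (hW : IsSimpleCoideal W) :
    ∃ (n : ℕ) (F : Fin n → H) (c : ℂ), 0 < c.re ∧ LinearIndependent ℂ F ∧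
      Submodule.span ℂ (Set.range F) = W ∧ ∀ i j, l2Form I (F i) (F j) = if i = j then c else 0 := by
  have := finiteDimensional_starSubmodule W
  obtain ⟨n, f, u, hu, hf⟩ := (hW.starSubmodule hH).exists_basis hH
  obtain ⟨m, e, v, hv, he⟩ := hW.exists_basis hH
  let F (i : Fin n) : H := star (f i : H)
  let ρ : Matrix (Fin n) (Fin n) H := u.map star
  have hF : LinearIndependent ℂ F := by
    rw [Fintype.linearIndependent_iff]
    intro g hg i
    have h1 : ∑ i, conj (g i) • f i = 0 := by
      ext
      simpa [F] using congrArg star hg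
    simpa using Fintype.linearIndependent_iff.1 f.linearIndependent _ h1 i
  have hexp (w : H) (hw : w ∈ W) : ∃ x : Fin n → ℂ, w = ∑ i, x i • F i := by
    have hw' : star w ∈ CompactHopf.starSubmodule W := by simpa [mem_starSubmodule] using hw
    refine ⟨fun i => conj (f.repr ⟨_, hw'⟩ i), ?_⟩
    have := congrArg (fun y : CompactHopf.starSubmodule W => star (y : H)) (f.sum_repr ⟨_, hw'⟩)
    simp only [Submodule.coe_sum, Submodule.coe_smul, star_sum, star_smul, star_star] at this
    exact this.symm
  have hspan : Submodule.span ℂ (Set.range F) = W := by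
    apply le_antisymm
    · rw [Submodule.span_le]
      rintro _ ⟨i, rfl⟩
      exact mem_starSubmodule.1 (f i).2
    · intro w hw
      obtain ⟨x, rfl⟩ := hexp w hw
      exact Submodule.sum_mem _ fun i _ => Submodule.smul_mem _ _ (Submodule.subset_span ⟨i, rfl⟩)
  have hρ (j) : comul (R := ℂ) (F j) = ∑ i, F i ⊗ₜ[ℂ] ρ i j := comul_star_of_eq_sum hH (hf j)
  let N : Matrix (Fin n) (Fin n) ℂ := fun i j => l2Form I (F j) (F i)
  -- The coaction matrix of `F` has entries `u_ij^*`, so the adjoint form evaluates `S` on `u_ij`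
  -- itself, where it is known; a unitary basis of `W` would produce `S²` instead.
  obtain ⟨c, hc⟩ := hW.eq_scalar hF hspan hρ N fun φ => by
    ext i j
    have h := l2Form_act hH hI φ (F j) (F i)
    rw [act_eq_sum (hρ j), act_eq_sum (hρ i)] at h
    simp only [map_sum, map_smul, map_smulₛₗ, LinearMap.sum_apply, LinearMap.smul_apply] at h
    rw [Matrix.mul_apply, Matrix.mul_apply]
    simpa [N, ρ, adjointForm, hu.antipode_apply, mul_comm] using h
  have horth (i j) : l2Form I (F i) (F j) = if i = j then c else 0 := by
    have := congrFun (congrFun hc j) i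
    simpa [N, Matrix.one_apply, eq_comm] using this
  refine ⟨n, F, c, ?_, hF, hspan, horth⟩
  have hreal (w : H) (hw : w ∈ W) : ∃ r : ℝ, 0 ≤ r ∧ l2Form I w w = c * r := by
    obtain ⟨x, rfl⟩ := hexp w hw
    refine ⟨∑ i, ‖x i‖ ^ 2, by positivity, ?_⟩
    simp only [map_sum, map_smul, map_smulₛₗ, LinearMap.sum_apply, LinearMap.smul_apply, horth,
      smul_eq_mul]
    rw [Complex.ofReal_sum, Finset.mul_sum]
    refine Finset.sum_congr rfl fun i _ => ?_
    rw [Complex.ofReal_pow, ← Complex.mul_conj']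
    simp
    ring
  choose r hr hrL using fun b : Fin m => hreal (e b) (e b).2
  let η (a : Fin m) : ℂ := counit (R := ℂ) (e a : H)
  have heη (b) : (e b : H) = ∑ a, η a • v a b := eq_sum_counit_smul (he b)
  -- Since `e_b = ∑ η_a v_ab` with `v` unitary, `∑ e_b e_b^* = ∑ |η_a|² · 1`.
  have hsum : ∑ b, l2Form I (e b : H) (e b : H) = ((∑ a, ‖η a‖ ^ 2 : ℝ) : ℂ) := by
    have h1 (b) : (e b : H) * star (e b : H) =
        ∑ a, ∑ a', (η a * conj (η a')) • (v a b * star (v a' b)) := by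
      conv_lhs => rw [heη b]
      simp [Finset.sum_mul_sum, smul_smul, mul_comm]
    have h2 (a a' : Fin m) : ∑ b, v a b * star (v a' b) = if a = a' then 1 else 0 := by
      simpa [Matrix.mul_apply, Matrix.one_apply] using
        congrArg (fun A : Matrix (Fin m) (Fin m) H => A a a') hv.mul_conjTranspose
    have h3 : ∑ b, (e b : H) * star (e b : H) = ∑ a, (η a * conj (η a)) • (1 : H) := by
      simp only [h1]
      rw [Finset.sum_comm]
      refine Finset.sum_congr rfl fun a _ => ?_
      rw [Finset.sum_comm]
      simp only [← Finset.smul_sum, h2]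
      simp
    simp only [l2Form_apply, ← map_sum, h3]
    simp [hI.map_one, Complex.mul_conj']
  have hm : Nonempty (Fin m) := by
    by_contra h
    rw [not_nonempty_iff] at h
    apply hW.2.1
    have := Module.finrank_eq_card_basis e
    simpa using this
  -- If every counit value `η_a` vanished, so would every basis vector `e_b`.
  have hη : 0 < ∑ a, ‖η a‖ ^ 2 := by
    by_contra h
    have h0 : ∑ a, ‖η a‖ ^ 2 = 0 := le_antisymm (not_lt.1 h) (by positivity)
    rw [Finset.sum_eq_zero_iff_of_nonneg (fun _ _ => by positivity)] at h0
    have h0' (a) : η a = 0 := by simpa using h0 a (Finset.mem_univ a)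
    have : (e hm.some : H) = 0 := by rw [heη]; simp [h0']
    exact e.ne_zero hm.some (by simpa using this)
  simp only [hrL, ← Finset.mul_sum, ← Complex.ofReal_sum] at hsum
  have h2 := congrArg Complex.re hsum
  rw [Complex.re_mul_ofReal, Complex.ofReal_re] at h2
  have h3 : 0 ≤ ∑ b, r b := Finset.sum_nonneg fun b _ => hr b
  by_contra h
  nlinarith [mul_nonneg (neg_nonneg.2 (not_lt.1 h)) h3]

omit [StarRing H] [StarModule ℂ H] in
-- A nonzero coideal of least dimension inside `V` is simple.
theorem exists_isSimpleCoideal_le {V : Submodule ℂ H} [FiniteDimensional ℂ V] (hV : IsCoideal V)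
    (hV0 : V ≠ ⊥) : ∃ W ≤ V, IsSimpleCoideal W := by
  classical
  have hex : ∃ k, ∃ W ≤ V, IsCoideal W ∧ W ≠ ⊥ ∧ Module.finrank ℂ W = k :=
    ⟨_, V, le_rfl, hV, hV0, rfl⟩
  obtain ⟨W, hWV, hW, hW0, hk⟩ := Nat.find_spec hex
  refine ⟨W, hWV, hW, hW0, fun W' hW' hc => or_iff_not_imp_left.2 fun h0 => ?_⟩
  have : FiniteDimensional ℂ W := Submodule.finiteDimensional_of_le hWV
  refine Submodule.eq_of_le_of_finrank_le hW' ?_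
  rw [hk]
  exact Nat.find_min' hex ⟨W', hW'.trans hWV, hc, h0, rfl⟩

/-- Strong induction on the dimension: split off a simple `W`, on which the form is a positive
multiple of a standard one; the orthogonal of `W` in `V` is a smaller coideal. -/
theorem l2Form_pos_of_mem (hH : IsCompactHopfStarAlgebra H) (hI : IsNormalizedLeftIntegral I)
    (k : ℕ) : ∀ V : Submodule ℂ H, FiniteDimensional ℂ V → IsCoideal V → Module.finrank ℂ V = k →
      ∀ v ∈ V, v ≠ 0 → 0 < (l2Form I v v).re := by
  induction k using Nat.strong_induction_on with
  | _ k ih =>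
    intro V hfin hV hk v hv hv0
    obtain ⟨W, hWV, hW⟩ := exists_isSimpleCoideal_le hV fun h => hv0 (by simpa [h] using hv)
    have : FiniteDimensional ℂ W := Submodule.finiteDimensional_of_le hWV
    obtain ⟨n, F, c, hc, hF, hspan, horth⟩ := hW.exists_orthogonal_basis hH hI
    have hc0 : c ≠ 0 := by rintro rfl; simp at hc
    have hposW (x : Fin n → ℂ) : 0 ≤ (l2Form I (∑ i, x i • F i) (∑ i, x i • F i)).re ∧
        ((l2Form I (∑ i, x i • F i) (∑ i, x i • F i)).re = 0 → x = 0) := by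
      have h : (l2Form I (∑ i, x i • F i) (∑ i, x i • F i)).re = c.re * ∑ i, ‖x i‖ ^ 2 := by
        rw [← Complex.re_mul_ofReal, Complex.ofReal_sum, Finset.mul_sum]
        simp only [map_sum, map_smul, map_smulₛₗ, LinearMap.sum_apply, LinearMap.smul_apply,
          horth, smul_eq_mul, Complex.re_sum]
        refine Finset.sum_congr rfl fun i _ => ?_
        rw [Complex.ofReal_pow, ← Complex.mul_conj']
        simp
        ring
      rw [h]
      refine ⟨by positivity, fun h0 => ?_⟩
      have h1 := (mul_eq_zero.1 h0).resolve_left hc.ne'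
      rw [Finset.sum_eq_zero_iff_of_nonneg (fun _ _ => by positivity)] at h1
      ext i
      simpa using h1 i (Finset.mem_univ i)
    let V' : Submodule ℂ H := V ⊓ ⨅ i, LinearMap.ker ((l2Form I).flip (F i))
    have hV' (y : H) : y ∈ V' ↔ y ∈ V ∧ ∀ i, l2Form I y (F i) = 0 := by
      simp [V']
    have horthW (y : H) (hy : y ∈ V') (w : H) (hw : w ∈ W) : l2Form I y w = 0 := by
      rw [← hspan] at hw
      induction hw using Submodule.span_induction with
      | mem w hw =>
        obtain ⟨i, rfl⟩ := hw
        exact ((hV' y).1 hy).2 i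
      | zero => simp
      | add a b _ _ ha hb => rw [map_add, ha, hb, add_zero]
      | smul a b _ hb => rw [map_smulₛₗ, hb, smul_zero]
    have hFW (i) : F i ∈ W := hspan ▸ Submodule.subset_span ⟨i, rfl⟩
    have hcoV' : IsCoideal V' := by
      intro φ y hy
      refine (hV' _).2 ⟨hV φ y ((hV' y).1 hy).1, fun i => ?_⟩
      rw [l2Form_act hH hI]
      exact horthW y hy _ (hW.1 _ _ (hFW i))
    have hlt : Module.finrank ℂ V' < Module.finrank ℂ V := by
      refine Submodule.finrank_lt_finrank_of_lt (lt_of_le_of_ne inf_le_left fun h => ?_)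
      apply hW.2.1
      rw [← hspan, Submodule.span_eq_bot]
      rintro _ ⟨i, rfl⟩
      have := ((hV' (F i)).1 (h ▸ hWV (hFW i))).2 i
      rw [horth, if_pos rfl] at this
      exact absurd this hc0
    -- Coefficients of the orthogonal projection of `v` to `W`; each `F i` has square norm `c`.
    let x (i : Fin n) : ℂ := l2Form I v (F i) / c
    have hw : ∑ i, x i • F i ∈ W := Submodule.sum_mem _ fun i _ => Submodule.smul_mem _ _ (hFW i)
    have hy : v - ∑ i, x i • F i ∈ V' := by
      refine (hV' _).2 ⟨Submodule.sub_mem _ hv (hWV hw), fun j => ?_⟩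
      simp only [map_sub, map_sum, map_smul, LinearMap.sub_apply, LinearMap.sum_apply,
        LinearMap.smul_apply, horth]
      simp [x, hc0]
    obtain ⟨hp1, hp2⟩ := hposW x
    generalize hwdef : ∑ i, x i • F i = w at *
    have hyw := horthW _ hy w hw
    have hwy : l2Form I w (v - w) = 0 := by rw [← l2Form_conj_symm hH hI, hyw, map_zero]
    have hdec : l2Form I v v = l2Form I w w + l2Form I (v - w) (v - w) := by
      conv_lhs => rw [← add_sub_cancel w v]
      simp only [map_add, LinearMap.add_apply, hyw, hwy]
      ring
    rw [hdec, Complex.add_re]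
    by_cases h0 : v - w = 0
    · rw [h0, map_zero, Complex.zero_re, add_zero]
      refine lt_of_le_of_ne hp1 fun h => hv0 ?_
      rw [sub_eq_zero.1 h0, ← hwdef, hp2 h.symm]
      simp
    · have := ih _ (hk ▸ hlt) V' (Submodule.finiteDimensional_of_le inf_le_left) hcoV' rfl _ hy h0
      linarith

/-- The form `⟨a, b⟩ = I(a b^*)` is a scalar product. -/
theorem isScalarProduct_l2Form (hH : IsCompactHopfStarAlgebra H)
    (hI : IsNormalizedLeftIntegral I) : IsScalarProduct (l2Form I) where
  conj_symm := l2Form_conj_symm hH hI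
  pos v hv := by
    obtain ⟨V, hV, hfin, hvV⟩ := exists_finiteDimensional_coideal v
    exact l2Form_pos_of_mem hH hI _ V hfin hV rfl v hvV hv

end Positivity

/-! ### The convolution inequality -/

section Inequality

variable {H : Type u} [Ring H] [HopfAlgebra ℂ H] [StarRing H] [StarModule ℂ H] {I : H →ₗ[ℂ] ℂ}

omit [StarRing H] [StarModule ℂ H] in
theorem IsCoideal.exists_comul_eq_sum {V : Submodule ℂ H} (hV : IsCoideal V) {ι : Type*}
    [Fintype ι] (a : Module.Basis ι ℂ V) {h : H} (hh : h ∈ V) :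
    ∃ b : ι → H, comul (R := ℂ) h = ∑ i, (a i : H) ⊗ₜ[ℂ] b i := by
  obtain ⟨y, hy⟩ := hV.mem_range hh
  obtain ⟨c, rfl⟩ := TensorProduct.eq_repr_basis_left a y
  refine ⟨c, ?_⟩
  rw [← hy, Finsupp.sum_fintype _ _ (by simp)]
  simp

/-- Write `Δ(h) = ∑ a_i ⊗ b_i` with orthonormal `a_i`. Isometry of `Δ` gives `‖h‖² = ∑ ‖b_i‖²`,
while the image of `h` is `∑ ⟨b_i, f⟩ a_i`, of square norm `∑ |⟨b_i, f⟩|²`; Cauchy-Schwarz compares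
them termwise. -/
theorem norm_act_form_le (hH : IsCompactHopfStarAlgebra H) (hI : IsNormalizedLeftIntegral I)
    (hs : IsScalarProduct (l2Form I)) (f h : H) :
    ‖PreHilbert.of hs (act (form I f) h)‖ ≤ ‖PreHilbert.of hs h‖ * ‖PreHilbert.of hs f‖ := by
  have hnorm (x : H) : ‖PreHilbert.of hs x‖ ^ 2 = (l2Form I x x).re := by
    rw [← inner_self_eq_norm_sq (𝕜 := ℂ), PreHilbert.inner_of]
    rfl
  obtain ⟨V, hV, hfin, hh⟩ := exists_finiteDimensional_coideal h
  let V' : Submodule ℂ (PreHilbert hs) := V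
  have : FiniteDimensional ℂ V' := hfin
  let e := stdOrthonormalBasis ℂ V'
  let a : Module.Basis (Fin (Module.finrank ℂ V')) ℂ V := e.toBasis
  obtain ⟨b, hb⟩ := hV.exists_comul_eq_sum a hh
  have horth (i j) : l2Form I (a i : H) (a j) = if i = j then 1 else 0 := by
    have h1 := orthonormal_iff_ite.1 e.orthonormal j i
    have h2 : inner ℂ (e j) (e i) = l2Form I (a i : H) (a j) := by
      rw [Submodule.coe_inner]
      have h3 (i) : ((e i : V') : PreHilbert hs) = PreHilbert.of hs (a i : H) := by
        simp only [a]
        rfl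
      rw [h3, h3, PreHilbert.inner_of]
    rw [← h2, h1]
    simp [eq_comm]
  refine le_of_sq_le_sq ?_ (by positivity)
  have h1 : ‖PreHilbert.of hs h‖ ^ 2 = ∑ i, ‖PreHilbert.of hs (b i)‖ ^ 2 := by
    rw [hnorm, ← sum_l2Form_mul_l2Form hH hI hb]
    simp [horth, hnorm, -l2Form_apply]
  have h2 : ‖PreHilbert.of hs (act (form I f) h)‖ ^ 2 = ∑ i, ‖l2Form I (b i) f‖ ^ 2 := by
    rw [hnorm, act_eq_sum hb, ← Complex.ofReal_re (∑ i, ‖l2Form I (b i) f‖ ^ 2),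
      Complex.ofReal_sum]
    simp only [map_sum, map_smul, map_smulₛₗ, LinearMap.sum_apply, LinearMap.smul_apply, horth,
      Complex.ofReal_pow, ← Complex.mul_conj']
    simp [mul_comm]
  rw [h2, mul_pow, h1, Finset.sum_mul]
  refine Finset.sum_le_sum fun i _ => ?_
  rw [← mul_pow, ← PreHilbert.inner_of hs, mul_comm]
  gcongr
  exact norm_inner_le_norm _ _

/-- Duality: for `h = f * g`, moving `f` to the other side of `⟨h, h⟩` gives `‖h‖² ≤ ‖h‖ ‖f‖ ‖g‖`,
and a factor `‖h‖` cancels when it is nonzero. -/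
theorem norm_convolution_le (hH : IsCompactHopfStarAlgebra H) (hI : IsNormalizedLeftIntegral I)
    (hs : IsScalarProduct (l2Form I)) (f g : H) :
    ‖PreHilbert.of hs (convolution I f g)‖ ≤ ‖PreHilbert.of hs f‖ * ‖PreHilbert.of hs g‖ := by
  set h := convolution I f g with hh
  obtain h0 | h0 := (norm_nonneg (PreHilbert.of hs h)).eq_or_lt
  · rw [← h0]; positivity
  · refine le_of_mul_le_mul_right ?_ h0
    calc ‖PreHilbert.of hs h‖ * ‖PreHilbert.of hs h‖
        = ‖inner ℂ (PreHilbert.of hs h) (PreHilbert.of hs h)‖ := by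
          rw [inner_self_eq_norm_sq_to_K]; simp [sq]
      _ = ‖inner ℂ (PreHilbert.of hs (act (form I f) h)) (PreHilbert.of hs g)‖ := by
          rw [PreHilbert.inner_of, PreHilbert.inner_of, ← l2Form_convolution hH hI]
      _ ≤ ‖PreHilbert.of hs (act (form I f) h)‖ * ‖PreHilbert.of hs g‖ := norm_inner_le_norm _ _
      _ ≤ ‖PreHilbert.of hs h‖ * ‖PreHilbert.of hs f‖ * ‖PreHilbert.of hs g‖ := by
          gcongr
          exact norm_act_form_le hH hI hs f h
      _ = _ := by ring

/-- The convolution product as a bilinear map. -/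
def convolutionₗ (hs : IsScalarProduct (l2Form I)) :
    PreHilbert hs →ₗ[ℂ] PreHilbert hs →ₗ[ℂ] PreHilbert hs :=
  LinearMap.mk₂ ℂ (fun x y => PreHilbert.of hs
      (convolution I ((PreHilbert.of hs).symm x) ((PreHilbert.of hs).symm y)))
    (fun x x' y => by simp [convolution_add_left])
    (fun c x y => by simp [convolution_smul_left])
    (fun x y y' => by simp [convolution_add_right])
    (fun c x y => by simp [convolution_smul_right])

end Inequality

/-! ### Extension to the Hilbert space completion -/

section Completion

open UniformSpace

variable {E : Type*} [NormedAddCommGroup E] [NormedSpace ℂ E]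

/-- A bounded bilinear map extends to the completion with the same bound. -/
theorem exists_completion_bilinear (b : E →ₗ[ℂ] E →ₗ[ℂ] E) (hb : ∀ x y, ‖b x y‖ ≤ ‖x‖ * ‖y‖) :
    ∃ B : Completion E →L[ℂ] Completion E →L[ℂ] Completion E,
      (∀ x y : E, B x y = (b x y : E)) ∧ ∀ x y, ‖B x y‖ ≤ ‖x‖ * ‖y‖ := by
  let ι : E →L[ℂ] Completion E := Completion.toComplL
  have hι : DenseRange ι := Completion.denseRange_coe
  have hu : IsUniformInducing ι := Completion.isUniformInducing_coe E
  let β : E →L[ℂ] E →L[ℂ] E := b.mkContinuous₂ 1 (by simpa using hb)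
  let β' : E →L[ℂ] E →L[ℂ] Completion E := (ContinuousLinearMap.compL ℂ E E (Completion E) ι).comp β
  -- The two variables are extended by density one after the other, with a flip in between.
  let B₁ : Completion E →L[ℂ] E →L[ℂ] Completion E := β'.extend ι
  let B : Completion E →L[ℂ] Completion E →L[ℂ] Completion E := (B₁.flip.extend ι).flip
  have hB (x y : E) : B x y = (b x y : E) := by
    have h1 : B₁.flip.extend ι (ι y) = B₁.flip y := ContinuousLinearMap.extend_eq _ hι hu y
    have h2 : B₁ (ι x) = β' x := ContinuousLinearMap.extend_eq _ hι hu x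
    calc B x y = B₁.flip.extend ι (ι y) (ι x) := rfl
      _ = B₁ (ι x) y := by rw [h1]; rfl
      _ = _ := by rw [h2]; rfl
  refine ⟨B, hB, fun x y => ?_⟩
  induction x, y using Completion.induction_on₂ with
  | hp => exact isClosed_le (by fun_prop) (by fun_prop)
  | ih x y =>
    rw [hB, Completion.norm_coe, Completion.norm_coe, Completion.norm_coe]
    exact hb x y

end Completion

end CompactHopf

end

theorem mainTheorem7 {H : Type u} [Ring H] [HopfAlgebra ℂ H] [StarRing H] [StarModule ℂ H]
    (hH : IsCompactHopfStarAlgebra H) (I : H →ₗ[ℂ] ℂ) (hI : IsNormalizedLeftIntegral I) :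
    ∃ hs : IsScalarProduct (l2Form I),
      (∀ f g : H, l2Norm I (convolution I f g) ≤ l2Norm I f * l2Norm I g) ∧
      ∃ B : HilbertCompletion hs →L[ℂ] HilbertCompletion hs →L[ℂ] HilbertCompletion hs,
        (∀ f g : H, B (toCompletion hs f) (toCompletion hs g) =
          toCompletion hs (convolution I f g)) ∧
        (∀ x y : HilbertCompletion hs, ‖B x y‖ ≤ ‖x‖ * ‖y‖) ∧
        ∀ P : HilbertCompletion hs → HilbertCompletion hs → HilbertCompletion hs,
          Continuous (fun p : HilbertCompletion hs × HilbertCompletion hs => P p.1 p.2) →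
          (∀ f g : H, P (toCompletion hs f) (toCompletion hs g) =
            toCompletion hs (convolution I f g)) →
          ∀ x y : HilbertCompletion hs, P x y = B x y := by
  have hs := CompactHopf.isScalarProduct_l2Form hH hI
  have hnorm (f : H) : l2Norm I f = ‖PreHilbert.of hs f‖ := (PreHilbert.norm_of hs f).symm
  obtain ⟨B, hB, hBn⟩ := CompactHopf.exists_completion_bilinear (CompactHopf.convolutionₗ hs)
    fun x y => CompactHopf.norm_convolution_le hH hI hs _ _
  refine ⟨hs, fun f g => ?_, B, fun f g => hB _ _, hBn, fun P hP hPc x y => ?_⟩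
  · simp only [hnorm]
    exact CompactHopf.norm_convolution_le hH hI hs f g
  · induction x, y using UniformSpace.Completion.induction_on₂ with
    | hp => exact isClosed_eq hP (by fun_prop)
    | ih x y => exact (hPc x y).trans (hB x y).symm
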